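/- Let $M$ be a free abelian group of finite rank, $N=\mathrm{Hom}(M,\mathbb{Z})$, let $\mathbb{T}_N=\mathrm{Hom}(M,\mathbb{C}^*)$ be the complex torus with coordinate ring $\mathbb{C}[M]$, and let $\mathbb{U}_N=\mathrm{Hom}(M,\mathbb{U})$ be the compact real torus, where $\mathbb{U}=\{z\in\mathbb{C}:|z|=1\}$. Let $\arg\colon\mathbb{T}_N\to\mathbb{U}_N$ be the map induced by $\mathbb{C}^*\to\mathbb{U}$, $z\mapsto z/|z|$. Let $X\subset\mathbb{T}_N$ be a subvariety, that is, the set of common zeros of an ideal of $\mathbb{C}[M]$ (not necessarily irreducible), and let $\mathit{co}\mathscr{A}(X)=\arg(X)\subset\mathbb{U}_N$ be its coamoeba. Let $\mathbb{T}_X\subset\mathbb{T}_N$ be the largest subtorus that acts on $X$ by translation, where a subtorus is the image in $\mathbb{T}_N=N\otimes_{\mathbb Z}\mathbb{C}^*$ of $L\otimes_{\mathbb Z}\mathbb{C}^*$ for a subgroup $L\subset N$. Then \[ \dim \mathit{co}\mathscr{A}(X)\ \leq\ \min\{\dim\mathbb{T}_N,\ 2\dim X-\dim\mathbb{T}_X\}.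 \] Here $\dim\mathbb{T}_N$, $\dim X$ and $\dim\mathbb{T}_X$ are complex dimensions of algebraic varieties (Krull dimensions of coordinate rings), and $\dim\mathit{co}\mathscr{A}(X)$ is the real dimension of the semialgebraic set $\mathit{co}\mathscr{A}(X)$, i.e. the Krull dimension of the ring of real polynomial functions on it (the ring of functions generated over $\mathbb{R}$ by the real and imaginary parts of the characters $u\mapsto u(m)$, $m\in M$, of $\mathbb{U}_N$). The empty set has dimension $-\infty$. -/

import Mathlib

noncomputable section

namespace Coamoeba

/-- The complex torus `𝕋_N = Hom(M, ℂˣ)`, where `N = Hom(M, ℤ)`. -/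
abbrev ComplexTorus (M : Type*) [AddCommGroup M] : Type _ := Multiplicative M →* ℂˣ

/-- The compact real torus `𝕌_N = Hom(M, 𝕌)`, where `𝕌` is the group of complex numbers of
norm one. -/
abbrev RealTorus (M : Type*) [AddCommGroup M] : Type _ := Multiplicative M →* Circle

/-- The argument homomorphism `ℂˣ → 𝕌`, `z ↦ z / |z|`. -/
def argHom : ℂˣ →* Circle :=
  MonoidHom.mk' (fun z => ⟨(z : ℂ) / (‖(z : ℂ)‖ : ℂ), mem_sphere_zero_iff_norm.2 (by simp)⟩)
    fun a b => Circle.ext (show ((a * b : ℂˣ) : ℂ) / (‖((a * b : ℂˣ) : ℂ)‖ : ℂ) =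
      (a : ℂ) / (‖(a : ℂ)‖ : ℂ) * ((b : ℂ) / (‖(b : ℂ)‖ : ℂ)) by simp [mul_div_mul_comm])

variable {M : Type*} [AddCommGroup M]

/-- The argument map `𝕋_N → 𝕌_N`. -/
def argMap (x : ComplexTorus M) : RealTorus M := argHom.comp x

/-- The coamoeba of a subset of `𝕋_N`: its image under the argument map. -/
def coamoeba (X : Set (ComplexTorus M)) : Set (RealTorus M) := argMap '' X

/-- Evaluation of Laurent polynomials, the elements of the group ring `ℂ[M]`, at a point of
`𝕋_N`: the monomial with exponent `m` takes the value `x m`. -/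
def evalAt (x : ComplexTorus M) : AddMonoidAlgebra ℂ M →ₐ[ℂ] ℂ :=
  AddMonoidAlgebra.lift ℂ ℂ M ((Units.coeHom ℂ).comp x)

/-- A (possibly reducible) subvariety of `𝕋_N`: the set of common zeros of an ideal of Laurent
polynomials. -/
def IsSubvariety (X : Set (ComplexTorus M)) : Prop :=
  ∃ I : Ideal (AddMonoidAlgebra ℂ M), X = {x | ∀ f ∈ I, evalAt x f = 0}

/-- The ideal of all Laurent polynomials that vanish on `X`. -/
def vanishingIdeal (X : Set (ComplexTorus M)) : Ideal (AddMonoidAlgebra ℂ M) :=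
  ⨅ x ∈ X, RingHom.ker (evalAt x)

/-- The (complex) dimension of a subvariety: the Krull dimension of its coordinate ring
(`⊥` for the empty set). -/
def varietyDim (X : Set (ComplexTorus M)) : WithBot ℕ∞ :=
  ringKrullDim (AddMonoidAlgebra ℂ M ⧸ vanishingIdeal X)

/-- The ring of real polynomial functions on a subset `S` of the real algebraic variety `𝕌_N`.
It is generated by the real and imaginary parts of the characters `u ↦ u m`. -/
def polynomialFunctions (S : Set (RealTorus M)) : Subalgebra ℝ (S → ℝ) :=
  Algebra.adjoin ℝ
    (Set.range (fun (m : M) (u : S) => ((u : RealTorus M) (Multiplicative.ofAdd m) : ℂ).re) ∪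
      Set.range (fun (m : M) (u : S) => ((u : RealTorus M) (Multiplicative.ofAdd m) : ℂ).im))

/-- The (real) dimension of a semialgebraic subset of `𝕌_N`: the Krull dimension of its ring of
real polynomial functions (`⊥` for the empty set). This is the definition of the dimension of a
semialgebraic set of Bochnak, Coste and Roy. -/
def semialgebraicDim (S : Set (RealTorus M)) : WithBot ℕ∞ :=
  ringKrullDim (polynomialFunctions S)

/-- The one-parameter subgroup `t ↦ t ^ w` of `𝕋_N` given by `w ∈ N = Hom(M, ℤ)`; the point
`t ^ w` is the homomorphism `m ↦ t ^ ⟨m, w⟩`. -/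
def oneParam (w : M →+ ℤ) : ℂˣ →* ComplexTorus M where
  toFun t :=
    { toFun := fun m => t ^ w m.toAdd
      map_one' := by simp
      map_mul' := fun a b => by simp [zpow_add] }
  map_one' := by ext; simp
  map_mul' a b := by ext; simp [mul_zpow]

/-- The image in `𝕋_N` of the torus `𝕋_L = L ⊗ ℂˣ` of a subgroup `L ⊆ N`: it is generated by the
one-parameter subgroups with directions in `L`. -/
def subtorusOf (L : AddSubgroup (M →+ ℤ)) : Subgroup (ComplexTorus M) :=
  ⨆ w ∈ L, (oneParam w).range

/-- The subtori of `𝕋_N`. -/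
def IsSubtorus (T : Subgroup (ComplexTorus M)) : Prop :=
  ∃ L : AddSubgroup (M →+ ℤ), T = subtorusOf L

/-- The subgroup `T` of `𝕋_N` acts on `X` by translation. -/
def ActsOn (T : Subgroup (ComplexTorus M)) (X : Set (ComplexTorus M)) : Prop :=
  ∀ t ∈ T, ∀ x ∈ X, t * x ∈ X

/-- `T` is the largest subtorus of `𝕋_N` that acts on `X`. -/
def IsLargestSubtorusActingOn (T : Subgroup (ComplexTorus M)) (X : Set (ComplexTorus M)) : Prop :=
  IsGreatest {T' : Subgroup (ComplexTorus M) | IsSubtorus T' ∧ ActsOn T' X} T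

/-- There always is a largest subtorus that acts on `X`. -/
theorem exists_isLargestSubtorusActingOn (X : Set (ComplexTorus M)) :
    ∃ T : Subgroup (ComplexTorus M), IsLargestSubtorusActingOn T X := by
  let S : Submonoid (ComplexTorus M) :=
    { carrier := {t | ∀ x ∈ X, t * x ∈ X}
      one_mem' := fun x hx => by rwa [one_mul]
      mul_mem' := fun {a b} ha hb x hx => by
        rw [mul_assoc]
        exact ha _ (hb x hx) }
  let L : AddSubgroup (M →+ ℤ) :=
    { carrier := {w | ∀ t : ℂˣ, oneParam w t ∈ S}
      zero_mem' := fun t => by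
        have h : oneParam (0 : M →+ ℤ) t = 1 := by ext; simp [oneParam]
        rw [h]
        exact S.one_mem
      add_mem' := fun {a b} ha hb t => by
        have h : oneParam (a + b) t = oneParam a t * oneParam b t := by
          ext; simp [oneParam, zpow_add]
        rw [h]
        exact S.mul_mem (ha t) (hb t)
      neg_mem' := fun {a} ha t => by
        have h : oneParam (-a) t = oneParam a t⁻¹ := by ext; simp [oneParam]
        rw [h]
        exact ha _ }
  refine ⟨subtorusOf L, ⟨⟨L, rfl⟩, ?_⟩, ?_⟩
  · intro t ht
    change t ∈ S
    refine Subgroup.iSup_induction (C := fun t => t ∈ S) _ ht (fun w y hy => ?_) S.one_mem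
      (fun a b => S.mul_mem)
    refine Subgroup.iSup_induction (C := fun t => t ∈ S) _ hy (fun hw z hz => ?_) S.one_mem
      (fun a b => S.mul_mem)
    obtain ⟨c, rfl⟩ := hz
    exact hw c
  · rintro T ⟨⟨L', rfl⟩, hT⟩
    refine iSup₂_le fun w hw => ?_
    have hwL : w ∈ L := fun t x hx =>
      hT _ (le_iSup₂ (f := fun (w : M →+ ℤ) (_ : w ∈ L') => (oneParam w).range) w hw ⟨t, rfl⟩) x hx
    exact le_iSup₂ (f := fun (w : M →+ ℤ) (_ : w ∈ L) => (oneParam w).range) w hwL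

end Coamoeba

end

/-! Work in the real algebra of functions `X → ℂ`. Noether normalization makes ℂ[X] integral over `d
= dim X` elements `z j`, so all characters and their conjugates are integral over the real algebra
generated by the `2d` functions `z j` and their conjugates. Since (z/|z|)² = z / conj z, the
characters of arg x are integral over it too, and hence so are the polynomial functions on the
coamoeba, pulled back injectively to `X`. The torus of `L` contributes `k` further functions: its
real positive points preserve arg but rescale `k` characters independently, so the squared absolute
values of these characters are algebraically independent over the pulled-back functions. If the
coamoeba has dimension `e`, then `e + k` independent elements are integral over `2d` generators, so
`e + k ≤ 2d` (`AlgebraicIndependent.card_le_of_isIntegral_adjoin`, `algebraicIndependent_normSq`,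
`isIntegral_adjoin_conj`), while `k` bounds the dimension of the torus. The bound by dim 𝕋_N is the
same count with the characters of a basis of `M` and their inverses. -/

/-! ### Krull dimension and algebraic independence in rings with zero divisors. -/

/-- An injective integral extension preserves the Krull dimension. -/
theorem ringKrullDim_eq_of_isIntegral_of_injective {A B : Type*} [CommRing A] [CommRing B]
    [Algebra A B] [Algebra.IsIntegral A B] (h : Function.Injective (algebraMap A B)) :
    ringKrullDim B = ringKrullDim A := by
  apply le_antisymm
  · refine Order.krullDim_le_of_strictMono (PrimeSpectrum.comap (algebraMap A B)) ?_
    intro p q hpq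
    exact Ideal.IsIntegral.comap_lt_comap (R := A) hpq
  · rw [ringKrullDim, Order.krullDim]
    refine iSup_le fun l => ?_
    obtain ⟨P, -, hP, hPl⟩ := Ideal.exists_ideal_over_prime_of_isIntegral l.head.asIdeal
      (⊥ : Ideal B) (by rw [← RingHom.ker_eq_comap_bot, (RingHom.injective_iff_ker_eq_bot _).1 h]
                        exact bot_le)
    have : P.LiesOver l.head.asIdeal := ⟨hPl.symm⟩
    obtain ⟨L, hL, -⟩ := Ideal.exists_ltSeries_of_hasGoingUp l P
    rw [← hL]
    exact le_iSup (fun L : LTSeries (PrimeSpectrum B) => (L.length : WithBot ℕ∞)) L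

/-- Noether normalization, together with the fact that the number of variables is the Krull
dimension. -/
theorem exists_algebraicIndependent_ringKrullDim_eq (K R : Type*) [Field K] [CommRing R]
    [Nontrivial R] [Algebra K R] [Algebra.FiniteType K R] :
    ∃ (d : ℕ) (x : Fin d → R), ringKrullDim R = d ∧ AlgebraicIndependent K x ∧
      ∀ r : R, IsIntegral (Algebra.adjoin K (Set.range x)) r := by
  obtain ⟨d, g, hg, hint⟩ := exists_integral_inj_algHom_of_fg K R
  have hgx : g = MvPolynomial.aeval (fun i => g (MvPolynomial.X i)) := by
    ext; simp
  refine ⟨d, fun i => g (MvPolynomial.X i), ?_, ?_, ?_⟩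
  · algebraize [g.toRingHom]
    have : Algebra.IsIntegral (MvPolynomial (Fin d) K) R := ⟨hint⟩
    rw [ringKrullDim_eq_of_isIntegral_of_injective (A := MvPolynomial (Fin d) K) hg]
    simp
  · rw [AlgebraicIndependent, ← hgx]
    exact hg
  · intro r
    have hmem : ∀ p, g p ∈ Algebra.adjoin K (Set.range fun i => g (MvPolynomial.X i)) := by
      intro p
      rw [Algebra.adjoin_range_eq_range_aeval, ← hgx]
      exact ⟨p, rfl⟩
    obtain ⟨p, hp, hpr⟩ := hint r
    refine ⟨p.map (g.codRestrict _ hmem).toRingHom, hp.map _, ?_⟩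
    rw [Polynomial.eval₂_map]
    exact hpr

/-- An algebraically independent family stays algebraically independent modulo some prime ideal. -/
theorem AlgebraicIndependent.exists_isPrime_quotient {ι K A : Type*} [Field K] [CommRing A]
    [Algebra K A] {y : ι → A} (hy : AlgebraicIndependent K y) :
    ∃ P : Ideal A, P.IsPrime ∧ AlgebraicIndependent K (Ideal.Quotient.mk P ∘ y) := by
  -- The zero ideal is the minimal prime of the polynomial ring, so injectivity of evaluation at `y`
  -- gives a prime of `A` contracting to it.
  obtain ⟨P, hP, hPy⟩ := Ideal.exists_comap_eq_of_mem_minimalPrimes_of_injective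
    (f := (MvPolynomial.aeval y : MvPolynomial ι K →ₐ[K] A).toRingHom) hy ⊥
    (by simp [IsDomain.minimalPrimes_eq_singleton_bot])
  refine ⟨P, hP, ?_⟩
  rw [algebraicIndependent_iff]
  intro p hp
  have h : Ideal.Quotient.mkₐ K P (MvPolynomial.aeval y p) = 0 := by
    rw [← hp, ← AlgHom.comp_apply, MvPolynomial.comp_aeval]
    rfl
  have h' : p ∈ Ideal.comap (MvPolynomial.aeval y : MvPolynomial ι K →ₐ[K] A).toRingHom P :=
    (Ideal.Quotient.eq_zero_iff_mem (I := P)).1 h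
  rwa [hPy] at h'

/-- In a domain, the algebraically independent elements that are algebraic over a subalgebra with
finitely many generators are no more than these generators. -/
theorem AlgebraicIndependent.card_le_of_isAlgebraic_adjoin {ι κ K A : Type*} [Fintype ι]
    [Fintype κ] [Field K] [CommRing A] [IsDomain A] [Algebra K A] {y : ι → A}
    (hy : AlgebraicIndependent K y) (z : κ → A)
    (h : ∀ i, IsAlgebraic (Algebra.adjoin K (Set.range z)) (y i)) :
    Fintype.card ι ≤ Fintype.card κ := by
  let Z := Algebra.adjoin K (Set.range z)
  -- Transcendence degrees are compared inside `C`, which contains both families and is algebraic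
  -- over the algebra generated by `z`.
  let C : Subalgebra K A := (Subalgebra.algebraicClosure Z A).restrictScalars K
  let y' : ι → C := fun i => ⟨y i, h i⟩
  have hzC : ∀ j, z j ∈ C := fun j =>
    isAlgebraic_algebraMap (⟨z j, Algebra.subset_adjoin ⟨j, rfl⟩⟩ : Z)
  let z' : κ → C := fun j => ⟨z j, hzC j⟩
  have hy' : AlgebraicIndependent K y' := AlgebraicIndependent.of_comp C.val hy
  have halg : Algebra.IsAlgebraic (Algebra.adjoin K (Set.range z')) C := by
    constructor
    rintro ⟨c, hc⟩
    obtain ⟨p, hp, hpc⟩ : IsAlgebraic Z c := hc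
    have hmap : (Algebra.adjoin K (Set.range z')).map C.val = Z := by
      rw [← Algebra.adjoin_image, ← Set.range_comp]
      rfl
    let e : Algebra.adjoin K (Set.range z') ≃ₐ[K] Z :=
      ((Algebra.adjoin K (Set.range z')).equivMapOfInjective C.val
        Subtype.val_injective).trans (Subalgebra.equivOfEq _ _ hmap)
    refine ⟨p.map e.symm.toRingEquiv.toRingHom, ?_, ?_⟩
    · rwa [Ne, Polynomial.map_eq_zero_iff e.symm.injective]
    · apply Subtype.val_injective
      rw [Polynomial.aeval_def, Polynomial.eval₂_map]
      change C.val.toRingHom (Polynomial.eval₂ _ _ _) = 0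
      rw [Polynomial.hom_eval₂]
      refine Eq.trans ?_ hpc
      refine congrArg₂ (fun f x => Polynomial.eval₂ f x p) ?_ rfl
      ext q
      obtain ⟨q, rfl⟩ := e.surjective q
      change ((e.symm (e q) : C) : A) = e q
      rw [e.symm_apply_apply]
      rfl
  have h1 := hy'.lift_cardinalMk_le_trdeg
  have h2 := Algebra.IsAlgebraic.trdeg_le_cardinalMk K (Set.range z')
  have h3 : Cardinal.mk (Set.range z') ≤ Fintype.card κ := by
    classical
    rw [Cardinal.mk_fintype]
    exact_mod_cast Fintype.card_range_le z'
  have h4 := h2.trans h3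
  rw [← Cardinal.lift_le] at h4
  have h5 := h1.trans h4
  simpa using h5

/-- The algebraically independent elements that are integral over an algebra generated by elements
`z j` and by inverses of some of the `z j` are no more than the `z j`. -/
theorem AlgebraicIndependent.card_le_of_isIntegral_adjoin {ι κ K A : Type*} [Fintype ι]
    [Fintype κ] [Field K] [CommRing A] [Algebra K A] {y : ι → A}
    (hy : AlgebraicIndependent K y) (z : κ → A) (W : Set A)
    (hW : ∀ w ∈ W, w ∈ Set.range z ∨ ∃ j, z j * w = 1)
    (h : ∀ i, IsIntegral (Algebra.adjoin K W) (y i)) :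
    Fintype.card ι ≤ Fintype.card κ := by
  obtain ⟨P, hP, hyP⟩ := hy.exists_isPrime_quotient
  refine hyP.card_le_of_isAlgebraic_adjoin (Ideal.Quotient.mk P ∘ z) fun i => ?_
  set Z := Algebra.adjoin K (Set.range (Ideal.Quotient.mk P ∘ z)) with hZ
  let C : Subalgebra K (A ⧸ P) := (Subalgebra.algebraicClosure Z (A ⧸ P)).restrictScalars K
  have hz : ∀ j, IsAlgebraic Z (Ideal.Quotient.mk P (z j)) := fun j =>
    isAlgebraic_algebraMap (⟨_, Algebra.subset_adjoin ⟨j, rfl⟩⟩ : Z)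
  have hle : Algebra.adjoin K W ≤ C.comap (Ideal.Quotient.mkₐ K P) := by
    refine Algebra.adjoin_le fun w hw => ?_
    change IsAlgebraic Z (Ideal.Quotient.mk P w)
    obtain ⟨j, rfl⟩ | ⟨j, hj⟩ := hW w hw
    · exact hz j
    · have hj' : Ideal.Quotient.mk P (z j) * Ideal.Quotient.mk P w = 1 := by
        rw [← map_mul, hj, map_one]
      -- In the fraction field `w` becomes the inverse of an algebraic element.
      let f := algebraMap (A ⧸ P) (FractionRing (A ⧸ P))
      have hf : Function.Injective f := IsFractionRing.injective _ _
      rw [← isAlgebraic_algebraMap_iff hf]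
      have : f (Ideal.Quotient.mk P w) = (f (Ideal.Quotient.mk P (z j)))⁻¹ :=
        eq_inv_of_mul_eq_one_right (by rw [← map_mul, hj', map_one])
      change IsAlgebraic Z (f _)
      rw [this]
      exact ((hz j).algebraMap).inv
  obtain ⟨p, hp, hpy⟩ := h i
  have hC : IsIntegral C (Ideal.Quotient.mk P (y i)) := by
    let φ : Algebra.adjoin K W →ₐ[K] C :=
      ((Ideal.Quotient.mkₐ K P).comp (Algebra.adjoin K W).val).codRestrict C fun w => hle w.2
    refine ⟨p.map φ.toRingHom, hp.map _, ?_⟩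
    rw [Polynomial.eval₂_map, ← map_zero (Ideal.Quotient.mk P), ← hpy, Polynomial.hom_eval₂]
    rfl
  have hC' : IsAlgebraic (Subalgebra.algebraicClosure Z (A ⧸ P)) (Ideal.Quotient.mk P (y i)) :=
    IsIntegral.isAlgebraic hC
  exact hC'.restrictScalars Z

noncomputable section

namespace Coamoeba

variable {M : Type*} [AddCommGroup M]

/-! ### Coordinate rings and rings of polynomial functions. -/

theorem evalAt_single (x : ComplexTorus M) (m : M) :
    evalAt x (AddMonoidAlgebra.single m 1) = x (Multiplicative.ofAdd m) := by
  simp [evalAt]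

theorem mem_vanishingIdeal {X : Set (ComplexTorus M)} {f : AddMonoidAlgebra ℂ M} :
    f ∈ vanishingIdeal X ↔ ∀ x ∈ X, evalAt x f = 0 := by
  simp [vanishingIdeal, Submodule.mem_iInf, RingHom.mem_ker]

theorem nontrivial_quotient_vanishingIdeal {X : Set (ComplexTorus M)} (hX : X.Nonempty) :
    Nontrivial (AddMonoidAlgebra ℂ M ⧸ vanishingIdeal X) := by
  obtain ⟨x, hx⟩ := hX
  rw [Ideal.Quotient.nontrivial_iff, Ne, Ideal.eq_top_iff_one, mem_vanishingIdeal]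
  intro h
  simpa using h x hx

/-- Restriction of Laurent polynomials to functions on `X`. -/
def restrict (X : Set (ComplexTorus M)) : AddMonoidAlgebra ℂ M →ₐ[ℂ] (X → ℂ) :=
  AlgHom.pi fun x : X => evalAt x.1

theorem addMonoidFG [Module.Finite ℤ M] : AddMonoid.FG M :=
  AddGroup.fg_iff_addMonoid_fg.1 (Module.Finite.iff_addGroup_fg.1 inferInstance)

theorem finiteType_polynomialFunctions [Module.Finite ℤ M] (S : Set (RealTorus M)) :
    Algebra.FiniteType ℝ (polynomialFunctions S) := by
  obtain ⟨s, hs⟩ := Module.Finite.fg_top (R := ℤ) (M := M)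
  let re : M → S → ℝ := fun m u => ((u : RealTorus M) (Multiplicative.ofAdd m) : ℂ).re
  let im : M → S → ℝ := fun m u => ((u : RealTorus M) (Multiplicative.ofAdd m) : ℂ).im
  let G : Set (S → ℝ) := re '' s ∪ im '' s
  have hG : G.Finite := (s.finite_toSet.image _).union (s.finite_toSet.image _)
  -- By the addition formulas for cosine and sine, the exponents whose real and imaginary parts are
  -- generated by `G` form a subgroup.
  let N : AddSubgroup M :=
    { carrier := {m | re m ∈ Algebra.adjoin ℝ G ∧ im m ∈ Algebra.adjoin ℝ G}
      zero_mem' := by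
        have h1 : re 0 = 1 := by ext; simp [re]
        have h2 : im 0 = 0 := by ext; simp [im]
        exact ⟨h1 ▸ one_mem _, h2 ▸ zero_mem _⟩
      add_mem' := fun {a b} ha hb => by
        have h1 : re (a + b) = re a * re b - im a * im b := by ext; simp [re, im]
        have h2 : im (a + b) = re a * im b + im a * re b := by ext; simp [re, im]
        refine ⟨h1 ▸ ?_, h2 ▸ ?_⟩
        · exact sub_mem (mul_mem ha.1 hb.1) (mul_mem ha.2 hb.2)
        · exact add_mem (mul_mem ha.1 hb.2) (mul_mem ha.2 hb.1)
      neg_mem' := fun {a} ha => by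
        have h1 : re (-a) = re a := by ext; simp [re]
        have h2 : im (-a) = -im a := by ext; simp [im]
        exact ⟨h1 ▸ ha.1, h2 ▸ neg_mem ha.2⟩ }
  have hN : ∀ m, m ∈ N := by
    intro m
    have hle : Submodule.span ℤ (s : Set M) ≤ N.toIntSubmodule :=
      Submodule.span_le.2 fun m hm => ⟨Algebra.subset_adjoin (Or.inl ⟨m, hm, rfl⟩),
        Algebra.subset_adjoin (Or.inr ⟨m, hm, rfl⟩)⟩
    exact hle (hs ▸ Submodule.mem_top)
  have heq : polynomialFunctions S = Algebra.adjoin ℝ G := by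
    apply le_antisymm
    · refine Algebra.adjoin_le ?_
      rintro _ (⟨m, rfl⟩ | ⟨m, rfl⟩)
      · exact (hN m).1
      · exact (hN m).2
    · refine Algebra.adjoin_mono (Set.union_subset_union ?_ ?_) <;>
      exact Set.image_subset_range _ _
  rw [← Subalgebra.fg_iff_finiteType, heq]
  exact Subalgebra.fg_def.2 ⟨G, hG, rfl⟩

/-! ### Subtori and their characters. -/

/-- A subgroup of `N` of rank `k` has `k` independent elements `w j`, dual up to nonzero factors to
elements `m i` of `M`, which generate the characters of the torus of the subgroup. -/
theorem exists_dual_family [Module.Free ℤ M] [Module.Finite ℤ M] (L : AddSubgroup (M →+ ℤ)) :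
    ∃ (k : ℕ) (w : Fin k → M →+ ℤ) (m : Fin k → M) (a : Fin k → ℤ), (∀ j, w j ∈ L) ∧
      (∀ j, a j ≠ 0) ∧ (∀ i j, w j (m i) = if i = j then a j else 0) ∧
      ∀ μ : M, ∃ c : Fin k → ℤ, ∀ v ∈ L, v μ = v (∑ i, c i • m i) := by
  classical
  let e : (M →+ ℤ) ≃ₗ[ℤ] (M →ₗ[ℤ] ℤ) := addMonoidHomLequivInt ℤ
  let b := ((Module.Free.chooseBasis ℤ M).dualBasis).map e.symm
  obtain ⟨k, snf⟩ := Submodule.smithNormalForm b (AddSubgroup.toIntSubmodule L)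
  -- By biduality, each coordinate functional on `N` in the Smith basis is evaluation at an element
  -- of `M`.
  let m : Fin k → M := fun i =>
    (Module.evalEquiv ℤ M).symm (snf.bM.coord (snf.f i) ∘ₗ e.symm.toLinearMap)
  have hm : ∀ (v : M →+ ℤ) i, v (m i) = snf.bM.coord (snf.f i) v := fun v i => by
    have h := Module.apply_evalEquiv_symm_apply ℤ M (e v)
      (snf.bM.coord (snf.f i) ∘ₗ e.symm.toLinearMap)
    exact h.trans (congrArg (snf.bM.coord (snf.f i)) (e.symm_apply_apply v))
  have hw : ∀ i j, (snf.bN j : M →+ ℤ) (m i) = if i = j then snf.a j else 0 := fun i j => by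
    rw [hm, snf.snf]
    simp [Finsupp.single_apply, eq_comm]
  refine ⟨k, fun j => snf.bN j, m, snf.a, fun j => (snf.bN j).2, fun j hj => ?_, hw, fun μ => ?_⟩
  · refine snf.bN.ne_zero j (Subtype.ext ?_)
    rw [snf.snf, hj, zero_smul]
    rfl
  -- On `snf.bN j`, which is `snf.a j` times `snf.bM (snf.f j)`, both sides equal `snf.a j` times
  -- the value of that basis vector at `μ`.
  · refine ⟨fun i => snf.bM (snf.f i) μ, fun v hv => ?_⟩
    let E : M → (AddSubgroup.toIntSubmodule L →ₗ[ℤ] ℤ) := fun μ =>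
      ((AddMonoidHom.eval μ).toIntLinearMap).comp (Submodule.subtype _)
    have hE : E μ = E (∑ i, snf.bM (snf.f i) μ • m i) := by
      refine snf.bN.ext fun j => ?_
      change (snf.bN j : M →+ ℤ) μ = (snf.bN j : M →+ ℤ) _
      rw [map_sum]
      simp only [map_zsmul, hw]
      rw [snf.snf]
      simp [mul_comm]
    exact LinearMap.congr_fun hE ⟨v, hv⟩

theorem apply_eq_one_of_mem_subtorusOf {L : AddSubgroup (M →+ ℤ)} {μ : M}
    (h : ∀ v ∈ L, v μ = 0) {t : ComplexTorus M} (ht : t ∈ subtorusOf L) :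
    t (Multiplicative.ofAdd μ) = 1 := by
  have hle : subtorusOf L ≤ (MonoidHom.eval (Multiplicative.ofAdd μ)).ker := by
    refine iSup₂_le fun w hw => ?_
    rintro _ ⟨c, rfl⟩
    change c ^ w μ = 1
    rw [h w hw, zpow_zero]
  exact hle ht

theorem varietyDim_subtorusOf_le [Module.Finite ℤ M] {L : AddSubgroup (M →+ ℤ)} {k : ℕ}
    (m : Fin k → M) (h : ∀ μ : M, ∃ c : Fin k → ℤ, ∀ v ∈ L, v μ = v (∑ i, c i • m i)) :
    varietyDim (subtorusOf L : Set (ComplexTorus M)) ≤ k := by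
  let X : Set (ComplexTorus M) := subtorusOf L
  have := addMonoidFG (M := M)
  have := nontrivial_quotient_vanishingIdeal (X := X) ⟨1, one_mem (subtorusOf L)⟩
  obtain ⟨d, x, hd, hx, -⟩ :=
    exists_algebraicIndependent_ringKrullDim_eq ℂ (AddMonoidAlgebra ℂ M ⧸ vanishingIdeal X)
  let q : M → AddMonoidAlgebra ℂ M ⧸ vanishingIdeal X := fun m =>
    Ideal.Quotient.mk _ (AddMonoidAlgebra.single m 1)
  have hq0 : q 0 = 1 := rfl
  have hqadd : ∀ a b, q (a + b) = q a * q b := fun a b => by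
    simp only [q, ← map_mul, AddMonoidAlgebra.single_mul_single, one_mul]
  let z : Fin k → AddMonoidAlgebra ℂ M ⧸ vanishingIdeal X := fun i => q (m i)
  let W : Set (AddMonoidAlgebra ℂ M ⧸ vanishingIdeal X) :=
    Set.range z ∪ Set.range fun i => q (-m i)
  let N : AddSubgroup M :=
    { carrier := {m | q m ∈ Algebra.adjoin ℂ W ∧ q (-m) ∈ Algebra.adjoin ℂ W}
      zero_mem' := by simp [hq0, one_mem]
      add_mem' := fun {a b} ha hb => by
        refine ⟨?_, ?_⟩
        · rw [hqadd]
          exact mul_mem ha.1 hb.1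
        · rw [neg_add, hqadd]
          exact mul_mem ha.2 hb.2
      neg_mem' := fun {a} ha => ⟨ha.2, by simpa using ha.1⟩ }
  have hN : ∀ i, m i ∈ N := fun i =>
    ⟨Algebra.subset_adjoin (Or.inl ⟨i, rfl⟩), Algebra.subset_adjoin (Or.inr ⟨i, rfl⟩)⟩
  have hall : ∀ μ, q μ ∈ Algebra.adjoin ℂ W := fun μ => by
    obtain ⟨c, hc⟩ := h μ
    have : q μ = q (∑ i, c i • m i) := by
      refine (Ideal.Quotient.mk_eq_mk_iff_sub_mem _ _).2 (mem_vanishingIdeal.2 fun t ht => ?_)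
      rw [map_sub, evalAt_single, evalAt_single, sub_eq_zero]
      have h1 := apply_eq_one_of_mem_subtorusOf (μ := μ - ∑ i, c i • m i)
        (fun v hv => by rw [map_sub, hc v hv, sub_self]) ht
      rw [ofAdd_sub, map_div, div_eq_one] at h1
      rw [h1]
    rw [this]
    exact (sum_mem fun i _ => zsmul_mem (hN i) _ : _ ∈ N).1
  have htop : ∀ r : AddMonoidAlgebra ℂ M ⧸ vanishingIdeal X, r ∈ Algebra.adjoin ℂ W := by
    intro r
    obtain ⟨f, rfl⟩ := Ideal.Quotient.mk_surjective r
    induction f using AddMonoidAlgebra.induction_on with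
    | of μ => exact hall _
    | add f g hf hg =>
      rw [map_add]
      exact add_mem hf hg
    | smul c f hf => exact Subalgebra.smul_mem _ hf c
  have hcard := hx.card_le_of_isIntegral_adjoin z W ?_ fun i =>
    isIntegral_algebraMap (x := (⟨x i, htop _⟩ : Algebra.adjoin ℂ W))
  · rw [varietyDim, hd]
    simp only [Fintype.card_fin] at hcard
    exact_mod_cast hcard
  · rintro _ (h | ⟨i, rfl⟩)
    · exact Or.inl h
    · refine Or.inr ⟨i, ?_⟩
      rw [← hqadd, add_neg_cancel, hq0]

/-! ### Functions on `X` and pullbacks from the coamoeba. -/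

/-- The coordinate ring of `X` as a ring of functions on `X`. -/
def restrictQuotient (X : Set (ComplexTorus M)) :
    AddMonoidAlgebra ℂ M ⧸ vanishingIdeal X →ₐ[ℂ] (X → ℂ) :=
  Ideal.Quotient.liftₐ _ (restrict X) fun _ hf => funext fun x => mem_vanishingIdeal.1 hf x.1 x.2

theorem restrictQuotient_single (X : Set (ComplexTorus M)) (m : M) :
    restrictQuotient X (Ideal.Quotient.mk _ (AddMonoidAlgebra.single m 1)) =
      fun x : X => (x.1 (Multiplicative.ofAdd m) : ℂ) :=
  funext fun x => evalAt_single x.1 m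

/-- Pulling back real polynomial functions on `S` to complex valued functions along a map to `S`. -/
def pullback {S : Set (RealTorus M)} {Y : Type*} (π : Y → S) :
    polynomialFunctions S →ₐ[ℝ] (Y → ℂ) :=
  (AlgHom.pi fun y => Complex.ofRealAm.comp (Pi.evalAlgHom ℝ (fun _ : S => ℝ) (π y))).comp
    (polynomialFunctions S).val

theorem pullback_apply {S : Set (RealTorus M)} {Y : Type*} (π : Y → S)
    (f : polynomialFunctions S) (y : Y) : pullback π f y = (f.1 (π y) : ℂ) := rfl

theorem pullback_injective {S : Set (RealTorus M)} {Y : Type*} {π : Y → S}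
    (hπ : Function.Surjective π) : Function.Injective (pullback π) := by
  intro f g h
  refine Subtype.ext (funext fun u => ?_)
  obtain ⟨y, rfl⟩ := hπ u
  exact Complex.ofReal_injective (congrFun h y)

/-- On the compact torus the character of `-m` is the conjugate of that of `m`, so `i` and the
characters yield all real and imaginary parts. -/
theorem pullback_mem {S : Set (RealTorus M)} {Y : Type*} {π : Y → S} (C : Subalgebra ℝ (Y → ℂ))
    (hI : (fun _ => Complex.I) ∈ C)
    (hC : ∀ m : M, (fun y => ((π y).1 (Multiplicative.ofAdd m) : ℂ)) ∈ C)
    (f : polynomialFunctions S) : pullback π f ∈ C := by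
  let v : M → Y → ℂ := fun m y => ((π y).1 (Multiplicative.ofAdd m) : ℂ)
  have hinv : ∀ (m : M) (y : Y), v (-m) y = (starRingEnd ℂ) (v m y) := fun m y => by
    simp only [v]
    rw [ofAdd_neg, map_inv, Circle.coe_inv_eq_conj]
  obtain ⟨f, hf⟩ := f
  let Φ : (S → ℝ) →ₐ[ℝ] (Y → ℂ) :=
    AlgHom.pi fun y => Complex.ofRealAm.comp (Pi.evalAlgHom ℝ (fun _ : S => ℝ) (π y))
  suffices polynomialFunctions S ≤ C.comap Φ from this hf
  refine Algebra.adjoin_le ?_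
  rintro _ (⟨m, rfl⟩ | ⟨m, rfl⟩)
  · change Φ _ ∈ C
    convert C.smul_mem (add_mem (hC m) (hC (-m))) (2⁻¹ : ℝ) using 1
    funext y
    change (((v m y).re : ℝ) : ℂ) = (2⁻¹ : ℝ) • (v m y + v (-m) y)
    rw [hinv, Complex.add_conj, Complex.real_smul]
    push_cast
    ring
  · change Φ _ ∈ C
    convert C.smul_mem (mul_mem hI (sub_mem (hC (-m)) (hC m))) (2⁻¹ : ℝ) using 1
    funext y
    change (((v m y).im : ℝ) : ℂ) = (2⁻¹ : ℝ) • (Complex.I * (v (-m) y - v m y))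
    rw [hinv, ← neg_sub, Complex.sub_conj, Complex.real_smul]
    push_cast
    linear_combination ((v m y).im : ℂ) * Complex.I_sq

theorem I_mem_integralClosure {Y : Type*} (A : Subalgebra ℝ (Y → ℂ)) :
    (fun _ => Complex.I) ∈ integralClosure A (Y → ℂ) := by
  refine IsIntegral.of_pow (n := 2) two_pos ?_
  have : (fun _ => Complex.I : Y → ℂ) ^ 2 = -1 := by ext; simp
  rw [this]
  exact isIntegral_one.neg

theorem nontrivial_polynomialFunctions {S : Set (RealTorus M)} (hS : S.Nonempty) :
    Nontrivial (polynomialFunctions S) := by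
  have := hS.to_subtype
  infer_instance

/-! ### The bound by the dimension of the ambient torus. -/

theorem semialgebraicDim_empty : semialgebraicDim (∅ : Set (RealTorus M)) = ⊥ := by
  have : Subsingleton (polynomialFunctions (∅ : Set (RealTorus M))) :=
    ⟨fun a b => Subtype.ext (Subsingleton.elim _ _)⟩
  exact ringKrullDim_eq_bot_of_subsingleton

theorem semialgebraicDim_le_finrank [Module.Free ℤ M] [Module.Finite ℤ M]
    (S : Set (RealTorus M)) : semialgebraicDim S ≤ Module.finrank ℤ M := by
  obtain rfl | hS := S.eq_empty_or_nonempty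
  · rw [semialgebraicDim_empty]
    exact bot_le
  have := nontrivial_polynomialFunctions hS
  have := finiteType_polynomialFunctions S
  obtain ⟨e, y, he, hy, -⟩ :=
    exists_algebraicIndependent_ringKrullDim_eq ℝ (polynomialFunctions S)
  let b := Module.Free.chooseBasis ℤ M
  let u : M → S → ℂ := fun m s => (s.1 (Multiplicative.ofAdd m) : ℂ)
  have hu0 : u 0 = 1 := by ext; simp [u]
  have huadd : ∀ m n, u (m + n) = u m * u n := fun m n => by ext; simp [u]
  let z : Module.Free.ChooseBasisIndex ℤ M → S → ℂ := fun i => u (b i)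
  let W : Set (S → ℂ) := Set.range z ∪ Set.range fun i => u (-b i)
  let N : AddSubgroup M :=
    { carrier := {m | u m ∈ Algebra.adjoin ℝ W ∧ u (-m) ∈ Algebra.adjoin ℝ W}
      zero_mem' := by simp [hu0, one_mem]
      add_mem' := fun {a b} ha hb => by
        refine ⟨?_, ?_⟩
        · rw [huadd]
          exact mul_mem ha.1 hb.1
        · rw [neg_add, huadd]
          exact mul_mem ha.2 hb.2
      neg_mem' := fun {a} ha => ⟨ha.2, by simpa using ha.1⟩ }
  have hN : ∀ m, m ∈ N := fun m => by
    have hle : Submodule.span ℤ (Set.range b) ≤ N.toIntSubmodule :=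
      Submodule.span_le.2 (Set.range_subset_iff.2 fun i =>
        ⟨Algebra.subset_adjoin (Or.inl ⟨i, rfl⟩), Algebra.subset_adjoin (Or.inr ⟨i, rfl⟩)⟩)
    exact hle (b.mem_span m)
  have hy' := hy.map' (f := pullback (id : S → S))
    (pullback_injective Function.surjective_id)
  have hcard := hy'.card_le_of_isIntegral_adjoin z W ?_ fun i =>
    pullback_mem (π := (id : S → S))
      ((integralClosure (Algebra.adjoin ℝ W) (S → ℂ)).restrictScalars ℝ)
      (I_mem_integralClosure _)
      (fun m => isIntegral_algebraMap (x := (⟨u m, (hN m).1⟩ : Algebra.adjoin ℝ W))) (y i)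
  · rw [semialgebraicDim, he, Module.finrank_eq_card_chooseBasisIndex]
    simp only [Fintype.card_fin] at hcard
    exact_mod_cast hcard
  · rintro _ (h | ⟨i, rfl⟩)
    · exact Or.inl h
    · refine Or.inr ⟨i, ?_⟩
      rw [← huadd, add_neg_cancel, hu0]

/-- The characters of a basis take arbitrary nonzero values independently, so a polynomial relation
between them vanishes on a product of infinite sets. -/
theorem finrank_le_varietyDim_univ [Module.Free ℤ M] [Module.Finite ℤ M] :
    Module.finrank ℤ M ≤ varietyDim (Set.univ : Set (ComplexTorus M)) := by
  let X : Set (ComplexTorus M) := Set.univ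
  have := addMonoidFG (M := M)
  have := nontrivial_quotient_vanishingIdeal (X := X) ⟨1, trivial⟩
  obtain ⟨d, x, hd, -, hx⟩ :=
    exists_algebraicIndependent_ringKrullDim_eq ℂ (AddMonoidAlgebra ℂ M ⧸ vanishingIdeal X)
  let b := Module.Free.chooseBasis ℤ M
  let y : Module.Free.ChooseBasisIndex ℤ M → AddMonoidAlgebra ℂ M ⧸ vanishingIdeal X := fun i =>
    Ideal.Quotient.mk _ (AddMonoidAlgebra.single (b i) 1)
  have hy : AlgebraicIndependent ℂ y := by
    refine AlgebraicIndependent.of_comp (restrictQuotient X) ?_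
    rw [algebraicIndependent_iff]
    intro p hp
    refine MvPolynomial.funext_set (fun _ => {0}ᶜ) (fun _ => (Set.finite_singleton 0).infinite_compl)
      fun c hc => ?_
    have hc0 : ∀ i, c i ≠ 0 := fun i => hc i trivial
    let t : ComplexTorus M := AddMonoidHom.toMultiplicativeLeft
      (b.constr ℤ fun i => Additive.ofMul (Units.mk0 (c i) (hc0 i))).toAddMonoidHom
    have ht : ∀ i, (t (Multiplicative.ofAdd (b i)) : ℂ) = c i := fun i => by
      simp [t]
    have h := congrArg (Pi.evalAlgHom ℂ (fun _ : X => ℂ) ⟨t, trivial⟩) hp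
    rw [← AlgHom.comp_apply, MvPolynomial.comp_aeval, map_zero] at h
    rw [map_zero, ← h, MvPolynomial.aeval_eq_eval]
    congr 2
    funext i
    change c i = restrictQuotient X (y i) ⟨t, trivial⟩
    rw [restrictQuotient_single, ← ht]
  have hcard := hy.card_le_of_isIntegral_adjoin x (Set.range x) (fun _ h => Or.inl h)
    fun i => hx (y i)
  rw [varietyDim, hd, Module.finrank_eq_card_chooseBasisIndex]
  simp only [Fintype.card_fin] at hcard
  exact_mod_cast hcard

/-! ### The argument map and translation by real positive points. -/

theorem coe_argHom (z : ℂˣ) : (argHom z : ℂ) = (z : ℂ) / (‖(z : ℂ)‖ : ℂ) := rfl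

theorem argHom_eq_one_of_pos {r : ℝ} (hr : 0 < r) {z : ℂˣ} (hz : (z : ℂ) = r) :
    argHom z = 1 := by
  refine Circle.ext ?_
  rw [coe_argHom, hz, Complex.norm_real, Real.norm_of_nonneg hr.le, Circle.coe_one,
    div_self (Complex.ofReal_ne_zero.2 hr.ne')]

/-- This follows from |z|² = z · conj z, and makes arguments integral over characters and conjugate
characters. -/
theorem argHom_sq (z : ℂˣ) : (argHom z : ℂ) ^ 2 = z * (starRingEnd ℂ) ((z⁻¹ : ℂˣ) : ℂ) := by
  have hz : (starRingEnd ℂ) (z : ℂ) ≠ 0 := by simp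
  have hn : (‖(z : ℂ)‖ : ℂ) ^ 2 ≠ 0 := by simp
  rw [coe_argHom, div_pow, Units.val_inv_eq_inv_val, map_inv₀, ← div_eq_mul_inv,
    div_eq_div_iff hn hz, ← Complex.mul_conj']
  ring

/-- The torus of `L` has real positive points with arbitrary prescribed values at the `m i`. -/
theorem exists_mem_subtorusOf_argMap_eq_one {L : AddSubgroup (M →+ ℤ)} {k : ℕ}
    {w : Fin k → M →+ ℤ} {m : Fin k → M} {a : Fin k → ℤ} (hw : ∀ j, w j ∈ L)
    (ha : ∀ j, a j ≠ 0) (hwm : ∀ i j, w j (m i) = if i = j then a j else 0)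
    (s : Fin k → ℝ) (hs : ∀ i, 0 < s i) :
    ∃ t ∈ subtorusOf L, argMap t = 1 ∧ ∀ i, (t (Multiplicative.ofAdd (m i)) : ℂ) = s i := by
  -- The character `m j` has value `r ^ a j` at the point `oneParam (w j) r`, which calls for an `a
  -- j`-th root.
  have hr : ∀ j, 0 < s j ^ ((a j : ℝ)⁻¹) := fun j => Real.rpow_pos_of_pos (hs j) _
  let r : Fin k → ℂˣ := fun j =>
    Units.mk0 ((s j ^ ((a j : ℝ)⁻¹) : ℝ) : ℂ) (Complex.ofReal_ne_zero.2 (hr j).ne')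
  have hr1 : ∀ j, argHom (r j) = 1 := fun j => argHom_eq_one_of_pos (hr j) rfl
  refine ⟨∏ j, oneParam (w j) (r j), ?_, ?_, fun i => ?_⟩
  · exact prod_mem fun j _ =>
      le_iSup₂ (f := fun (v : M →+ ℤ) (_ : v ∈ L) => (oneParam v).range) (w j) (hw j) ⟨r j, rfl⟩
  · ext μ
    simp [argMap, oneParam, hr1]
  · have h1 : (∏ j, oneParam (w j) (r j)) (Multiplicative.ofAdd (m i)) = r i ^ a i := by
      rw [MonoidHom.finsetProd_apply, Finset.prod_eq_single i]
      · simp [oneParam, hwm]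
      · intro j _ hj
        simp [oneParam, hwm, hj.symm]
      · simp
    rw [h1, Units.val_zpow_eq_zpow_val, Units.val_mk0, ← Complex.ofReal_zpow, ← Real.rpow_intCast,
      ← Real.rpow_mul (hs i).le, inv_mul_cancel₀ (Int.cast_ne_zero.2 (ha i)), Real.rpow_one]

/-- The squared absolute values of characters that can be prescribed by translations are
algebraically independent over functions that are invariant under these translations. -/
theorem algebraicIndependent_normSq {X : Set (ComplexTorus M)} {k : ℕ} (m : Fin k → M)
    (B : Subalgebra ℝ (X → ℂ))
    (hB : ∀ (x : X) (s : Fin k → ℝ), (∀ i, 0 < s i) → ∃ x' : X,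
      (∀ f ∈ B, f x' = f x) ∧ ∀ i, (x'.1 (Multiplicative.ofAdd (m i)) : ℂ) =
        s i * (x.1 (Multiplicative.ofAdd (m i)) : ℂ)) :
    AlgebraicIndependent B fun (i : Fin k) (x : X) =>
      (Complex.normSq (x.1 (Multiplicative.ofAdd (m i)) : ℂ) : ℂ) := by
  rw [algebraicIndependent_iff]
  intro p hp
  -- Freezing the coefficients of `p` at a point `x` gives a complex polynomial. The translates of
  -- `x` have the same coefficients but realize all positive values of the variables, so it
  -- vanishes.
  let ev : X → (B →+* ℂ) := fun x => (Pi.evalRingHom (fun _ : X => ℂ) x).comp B.val.toRingHom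
  have hev : ∀ x : X, MvPolynomial.eval (fun i =>
      (Complex.normSq (x.1 (Multiplicative.ofAdd (m i)) : ℂ) : ℂ))
      (MvPolynomial.map (ev x) p) = 0 := fun x => by
    have h := congrFun hp x
    rw [MvPolynomial.aeval_def] at h
    rw [MvPolynomial.eval_map]
    have h2 := MvPolynomial.eval₂_comp_left (Pi.evalRingHom (fun _ : X => ℂ) x)
      (algebraMap B (X → ℂ)) (fun (i : Fin k) (x : X) =>
      (Complex.normSq (x.1 (Multiplicative.ofAdd (m i)) : ℂ) : ℂ)) p
    exact h2.symm.trans h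
  have hzero : ∀ x : X, MvPolynomial.map (ev x) p = 0 := fun x => by
    refine MvPolynomial.funext_set (fun _ => Complex.ofReal '' Set.Ioi 0)
      (fun _ => (Set.Ioi_infinite 0).image Complex.ofReal_injective.injOn) fun c hc => ?_
    choose s hs hsc using fun i => hc i trivial
    have hn : ∀ i, 0 < Complex.normSq (x.1 (Multiplicative.ofAdd (m i)) : ℂ) := fun i =>
      Complex.normSq_pos.2 (Units.ne_zero _)
    obtain ⟨x', hx', hx'm⟩ := hB x
      -- Rescaling a character by a factor multiplies its `normSq` by the square of that factor.
      (fun i => √(s i / Complex.normSq (x.1 (Multiplicative.ofAdd (m i)) : ℂ)))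
      (fun i => Real.sqrt_pos.2 (div_pos (hs i) (hn i)))
    have heq : ev x = ev x' := RingHom.ext fun f => (hx' f.1 f.2).symm
    have hcx : c = fun i => (Complex.normSq (x'.1 (Multiplicative.ofAdd (m i)) : ℂ) : ℂ) := by
      funext i
      rw [hx'm, map_mul, Complex.normSq_ofReal,
        Real.mul_self_sqrt (div_pos (hs i) (hn i)).le, div_mul_cancel₀ _ (hn i).ne', hsc]
    rw [map_zero, heq, hcx, hev]
  ext α x
  have h := congrArg (MvPolynomial.coeff α) (hzero x)
  rw [MvPolynomial.coeff_map] at h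
  exact h

/-! ### Integrality over the real algebra generated by the `z j` and their conjugates. -/

/-- Complex conjugation of functions. -/
def conjFun (Y : Type*) : (Y → ℂ) →ₐ[ℝ] (Y → ℂ) := Complex.conjAe.toAlgHom.compLeft Y

theorem conjFun_apply {Y : Type*} (f : Y → ℂ) (y : Y) :
    conjFun Y f y = (starRingEnd ℂ) (f y) := rfl

theorem isIntegral_of_isIntegral_integralClosure {A B : Type*} [CommRing A] [CommRing B]
    [Algebra A B] {b : B} (hb : IsIntegral (integralClosure A B) b) : IsIntegral A b :=
  isIntegral_trans b hb

/-- If a complex algebra of functions is integral over `ℂ[z₁, …, z_d]`, then these functions are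
integral over the real algebra generated by the `z j` and their complex conjugates, and so are
their complex conjugates. -/
theorem isIntegral_adjoin_conj {Y R : Type*} [CommRing R] [Algebra ℂ R] (ρ : R →ₐ[ℂ] (Y → ℂ))
    {κ : Type*} (z : κ → R) (hz : ∀ r : R, IsIntegral (Algebra.adjoin ℂ (Set.range z)) r)
    (A : Subalgebra ℝ (Y → ℂ)) (hA : A = Algebra.adjoin ℝ
      (Set.range (Sum.elim (fun j => ρ (z j)) fun j => conjFun Y (ρ (z j))))) (r : R) :
    ρ r ∈ integralClosure A (Y → ℂ) ∧ conjFun Y (ρ r) ∈ integralClosure A (Y → ℂ) := by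
  let C := integralClosure A (Y → ℂ)
  have hzA : ∀ j, ρ (z j) ∈ A := fun j => hA ▸ Algebra.subset_adjoin ⟨Sum.inl j, rfl⟩
  have hzA' : ∀ j, conjFun Y (ρ (z j)) ∈ A := fun j =>
    hA ▸ Algebra.subset_adjoin ⟨Sum.inr j, rfl⟩
  -- The integral closure contains `i`, so it is a complex algebra although `A` is only a real one.
  have hconst : ∀ c : ℂ, algebraMap ℂ (Y → ℂ) c ∈ C := fun c => by
    have h1 : ∀ t : ℝ, algebraMap ℝ (Y → ℂ) t ∈ C := fun t =>
      isIntegral_algebraMap (x := algebraMap ℝ A t)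
    convert add_mem (h1 c.re) (mul_mem (h1 c.im) (I_mem_integralClosure A)) using 1
    funext y
    exact (Complex.re_add_im c).symm
  let C' : Subalgebra ℂ (Y → ℂ) :=
    { C.toSubsemiring with algebraMap_mem' := hconst }
  have hle : Algebra.adjoin ℂ (Set.range z) ≤ C'.comap ρ := by
    refine Algebra.adjoin_le (Set.range_subset_iff.2 fun j => ?_)
    exact (isIntegral_algebraMap (x := (⟨_, hzA j⟩ : A)) : IsIntegral A (ρ (z j)))
  have hr : IsIntegral A (ρ r) := by
    obtain ⟨p, hp, hpr⟩ := hz r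
    let φ : Algebra.adjoin ℂ (Set.range z) →+* C :=
      (ρ.toRingHom.comp (Algebra.adjoin ℂ (Set.range z)).val.toRingHom).codRestrict C
        fun w => hle w.2
    have hrC : IsIntegral C (ρ r) := by
      refine ⟨p.map φ, hp.map _, ?_⟩
      rw [Polynomial.eval₂_map, ← map_zero ρ, ← hpr]
      exact (Polynomial.hom_eval₂ p _ ρ.toRingHom r).symm
    exact isIntegral_of_isIntegral_integralClosure hrC
  refine ⟨hr, ?_⟩
  -- Conjugation permutes the generators of `A`, so it turns an integral equation over `A` into
  -- another one.
  have hconj : A ≤ A.comap (conjFun Y) := by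
    conv_lhs => rw [hA]
    refine Algebra.adjoin_le (Set.range_subset_iff.2 ?_)
    rintro (j | j)
    · exact hzA' j
    · have : conjFun Y (conjFun Y (ρ (z j))) = ρ (z j) := by
        ext
        simp [conjFun_apply]
      change conjFun Y (conjFun Y (ρ (z j))) ∈ A
      rw [this]
      exact hzA j
  obtain ⟨p, hp, hpr⟩ := hr
  let φ : A →+* A :=
    ((conjFun Y).toRingHom.comp A.val.toRingHom).codRestrict A fun w => hconj w.2
  refine ⟨p.map φ, hp.map _, ?_⟩
  rw [Polynomial.eval₂_map, ← map_zero (conjFun Y), ← hpr]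
  exact (Polynomial.hom_eval₂ p _ (conjFun Y).toRingHom _).symm

/-! ### The bound by the dimensions of `X` and of a torus acting on it. -/

theorem semialgebraicDim_coamoeba_add_varietyDim_le [Module.Free ℤ M] [Module.Finite ℤ M]
    (X : Set (ComplexTorus M)) (L : AddSubgroup (M →+ ℤ)) (hL : ActsOn (subtorusOf L) X) :
    semialgebraicDim (coamoeba X) + varietyDim (subtorusOf L : Set (ComplexTorus M)) ≤
      2 * varietyDim X := by
  obtain rfl | hX := X.eq_empty_or_nonempty
  · rw [coamoeba, Set.image_empty, semialgebraicDim_empty, WithBot.bot_add]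
    exact bot_le
  obtain ⟨k, w, m, a, hw, ha, hwm, hm⟩ := exists_dual_family L
  have hk := varietyDim_subtorusOf_le m hm
  have := addMonoidFG (M := M)
  have := nontrivial_quotient_vanishingIdeal hX
  have := nontrivial_polynomialFunctions (S := coamoeba X) (hX.image _)
  have := finiteType_polynomialFunctions (coamoeba X)
  obtain ⟨d, z, hd, -, hz⟩ :=
    exists_algebraicIndependent_ringKrullDim_eq ℂ (AddMonoidAlgebra ℂ M ⧸ vanishingIdeal X)
  obtain ⟨e, y, he, hy, -⟩ :=
    exists_algebraicIndependent_ringKrullDim_eq ℝ (polynomialFunctions (coamoeba X))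
  let π : X → coamoeba X := fun x => ⟨argMap x.1, x.1, x.2, rfl⟩
  have hπ : Function.Surjective π := by
    rintro ⟨_, x, hx, rfl⟩
    exact ⟨⟨x, hx⟩, rfl⟩
  have hy' := hy.map' (f := pullback π) (pullback_injective hπ)
  let n : Fin k → X → ℂ := fun i x =>
    (Complex.normSq (x.1 (Multiplicative.ofAdd (m i)) : ℂ) : ℂ)
  have hn : AlgebraicIndependent (Algebra.adjoin ℝ (Set.range (pullback π ∘ y))) n := by
    refine algebraicIndependent_normSq m _ fun x s hs => ?_
    obtain ⟨t, ht, ht1, htm⟩ := exists_mem_subtorusOf_argMap_eq_one hw ha hwm s hs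
    refine ⟨⟨t * x.1, hL t ht x.1 x.2⟩, fun f hf => ?_, fun i => ?_⟩
    · have harg : π ⟨t * x.1, hL t ht x.1 x.2⟩ = π x := by
        refine Subtype.ext ?_
        change argHom.comp (t * x.1) = argHom.comp x.1
        rw [MonoidHom.comp_mul]
        change argMap t * _ = _
        rw [ht1, one_mul]
      -- Everything generated by the pulled-back `y` factors through `π`, so it does not change
      -- under a translation that preserves arguments.
      have hle : Algebra.adjoin ℝ (Set.range (pullback π ∘ y)) ≤ (pullback π).range :=
        Algebra.adjoin_le (Set.range_subset_iff.2 fun i => ⟨y i, rfl⟩)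
      obtain ⟨g, rfl⟩ := hle hf
      change pullback π g _ = pullback π g _
      rw [pullback_apply, pullback_apply, harg]
    · rw [← htm]
      rfl
  let ρ := restrictQuotient X
  let Z : Fin d ⊕ Fin d → X → ℂ := Sum.elim (fun j => ρ (z j)) fun j => conjFun X (ρ (z j))
  let C := integralClosure (Algebra.adjoin ℝ (Set.range Z)) (X → ℂ)
  have hχ : ∀ μ : M, (fun x : X => (x.1 (Multiplicative.ofAdd μ) : ℂ)) ∈ C ∧
      conjFun X (fun x : X => (x.1 (Multiplicative.ofAdd μ) : ℂ)) ∈ C := fun μ => by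
    rw [← restrictQuotient_single]
    exact isIntegral_adjoin_conj ρ z hz _ rfl _
  have hu : ∀ μ : M, (fun x => ((π x).1 (Multiplicative.ofAdd μ) : ℂ)) ∈ C := fun μ => by
    refine IsIntegral.of_pow (n := 2) two_pos ?_
    change _ ∈ C
    convert mul_mem (hχ μ).1 (hχ (-μ)).2 using 1
    funext x
    refine (argHom_sq _).trans ?_
    rw [Pi.mul_apply, conjFun_apply, ofAdd_neg, map_inv]
  -- The count: `e + k` independent functions, integral over the algebra of the `2d` functions `Z`.
  have hcard := (hy'.sumElim hn).card_le_of_isIntegral_adjoin Z (Set.range Z)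
    (fun _ h => Or.inl h) (by
      rintro (i | i)
      · change n i ∈ C
        convert mul_mem (hχ (m i)).1 (hχ (m i)).2 using 1
        funext x
        exact (Complex.mul_conj _).symm
      · exact pullback_mem (C.restrictScalars ℝ) (I_mem_integralClosure _) hu (y i))
  simp only [Fintype.card_sum, Fintype.card_fin] at hcard
  calc semialgebraicDim (coamoeba X) + varietyDim (subtorusOf L : Set (ComplexTorus M))
      ≤ (e : WithBot ℕ∞) + k := by
        rw [semialgebraicDim, he]
        gcongr
    _ ≤ 2 * varietyDim X := by
        rw [varietyDim, hd]
        have : e + k ≤ 2 * d := by omega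
        exact_mod_cast this

end Coamoeba

end

/-- The minimum is split into two inequalities, and dim 𝕋_X is moved to the left to avoid
subtraction in `WithBot ℕ∞`. -/
theorem mainTheorem4 {M : Type*} [AddCommGroup M] [Module.Free ℤ M] [Module.Finite ℤ M]
    (X : Set (Coamoeba.ComplexTorus M)) (hX : Coamoeba.IsSubvariety X)
    (TX : Subgroup (Coamoeba.ComplexTorus M))
    (hTX : Coamoeba.IsLargestSubtorusActingOn TX X) :
    Coamoeba.semialgebraicDim (Coamoeba.coamoeba X) ≤
        Coamoeba.varietyDim (Set.univ : Set (Coamoeba.ComplexTorus M)) ∧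
      Coamoeba.semialgebraicDim (Coamoeba.coamoeba X) +
          Coamoeba.varietyDim (TX : Set (Coamoeba.ComplexTorus M)) ≤
        2 * Coamoeba.varietyDim X := by
  obtain ⟨⟨⟨L, rfl⟩, hact⟩, -⟩ := hTX
  exact ⟨(Coamoeba.semialgebraicDim_le_finrank _).trans Coamoeba.finrank_le_varietyDim_univ,
    Coamoeba.semialgebraicDim_coamoeba_add_varietyDim_le X L hact⟩
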